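/- **Definitions.** All graphs are simple with vertex set $[n]=\{1,\dots,n\}$. *Generalized graph shift.* Let $x\neq y$ be two vertices of $G_1$ that are not contained in one cycle of $G_1$, joined by a path $P$ all of whose interior vertices (if any) have degree $2$ in $G_1$, and let $w$ be the neighbour of $y$ on $P$. If $G_2$ is the graph obtained from $G_1$ by moving all neighbours of $y$ except $w$ to $x$ (each edge $yu$ with $u\ne w$ is replaced by $xu$), we write $G_2=\mathrm{GGS}(G_1)$. *Orientations.* For $B\subseteq[n]$, a $B$-orientation $O$ of $G$ assigns to each vertex $v\in B$ an arrow pointing from $v$ to one of its neighbours $O(v)$ in $G$ (which may or may not lie in $B$). It has type $\mu=(1^{n_1},2^{n_2},3^{n_3},\dots)\vdash n$ if it has exactly $n_2$ bidirected edges (edges with two arrows) and, for each $i\ge 3$, exactly $n_i$ directed $i$-cycles; so $n_1$ is the number of vertices of $[n]$ lying on no bidirected edge and no directed cycle. Let $a_{G,r}(\mu)$ be the number of $B$-orientations of $G$ of type $\mu$, over all $B\subseteq[n]$ with $|B|=r$. *Coefficients.* For $\lambda\vdash n$ let $\chi_\lambda$ be the irreducible character of the symmetric group $\mathfrak S_n$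 over $\mathbb C$ indexed by $\lambda$ (the character of the Specht module $S^\lambda$), and let $\mathrm{imm}_\lambda(A)=\sum_{\psi\in\mathfrak S_n}\chi_\lambda(\psi)\prod_{i=1}^n a_{i,\psi(i)}$. Let $L_G=D-A(G)$ be the Laplacian matrix of $G$, and define $b_{\lambda,r}(L_G)$, $0\le r\le n$, by $$\mathrm{imm}_\lambda(xI-L_G)=\sum_{r=0}^n(-1)^r\,b_{\lambda,r}(L_G)\,x^{n-r}.$$ **Theorem 5.3.** Let $G_1$ and $G_2$ be two bipartite graphs with $n$ vertices such that $G_2=\mathrm{GGS}(G_1)$. Then for all $r\ge 0$ and all partitions $\mu$ of $n$, $$a_{G_2,r}(\mu)\le a_{G_1,r}(\mu).$$ Consequently, for all $\lambda\vdash n$ and all $0\le r\le n$, the numbers $b_{\lambda,r}(L_{G_1})$ and $b_{\lambda,r}(L_{G_2})$ are real and $$b_{\lambda,r}(L_{G_2})\le b_{\lambda,r}(L_{G_1}).$$ -/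

import Mathlib

open Polynomial

noncomputable section

/-! ### Irreducible characters of the symmetric group (Specht modules) -/

/-- The Young diagram of a partition `lam` of `n`: its rows are the parts of `lam` in
weakly decreasing order. -/
def partitionDiagram {n : ℕ} (lam : n.Partition) : YoungDiagram :=
  YoungDiagram.ofRowLens (lam.parts.sort (· ≥ ·))
    (List.sortedGE_iff_pairwise.mpr (Multiset.pairwise_sort lam.parts (· ≥ ·)))

/-- A (bijective) Young tableau of shape `lam`: a filling of the cells of the diagram with the
`n` elements of `Fin n`, each used exactly once. -/
abbrev YTableau {n : ℕ} (lam : n.Partition) : Type :=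
  {c : ℕ × ℕ // c ∈ partitionDiagram lam} ≃ Fin n

/-- The index of the row of `T` that contains `v`. The function `T.rowOf` determines, and is
determined by, the tabloid `{T}` (the row equivalence class of `T`). -/
def YTableau.rowOf {n : ℕ} {lam : n.Partition} (T : YTableau lam) (v : Fin n) : ℕ :=
  (T.symm v).1.1

/-- The index of the column of `T` that contains `v`. -/
def YTableau.colOf {n : ℕ} {lam : n.Partition} (T : YTableau lam) (v : Fin n) : ℕ :=
  (T.symm v).1.2

/-- The permutation representation of `𝔖ₙ` on the free complex vector space over all functions
`Fin n → ℕ`; a tabloid is encoded by its row function, and `σ • {T} = {σT}` has the row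
function `rowOf T ∘ σ⁻¹`. -/
def tabloidRep (n : ℕ) :
    Representation ℂ (Equiv.Perm (Fin n)) ((Fin n → ℕ) →₀ ℂ) where
  toFun σ := Finsupp.lmapDomain ℂ ℂ (fun f : Fin n → ℕ => f ∘ ⇑(σ⁻¹))
  map_one' := by
    ext f
    simp
  map_mul' σ τ := by
    refine Finsupp.lhom_ext fun f a => ?_
    rw [Module.End.mul_apply]
    simp only [Finsupp.lmapDomain_apply, Finsupp.mapDomain_single, mul_inv_rev]
    rfl

open Classical in
/-- The polytabloid `e_T = ∑ sgn(σ) {σT}`, the sum running over the column stabilizer of `T`. -/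
def polytabloid {n : ℕ} {lam : n.Partition} (T : YTableau lam) : (Fin n → ℕ) →₀ ℂ :=
  ∑ σ : Equiv.Perm (Fin n) with ∀ v, T.colOf (σ v) = T.colOf v,
    Finsupp.single (T.rowOf ∘ ⇑(σ⁻¹)) ((Equiv.Perm.sign σ : ℤ) : ℂ)

theorem tabloidRep_polytabloid {n : ℕ} {lam : n.Partition} (τ : Equiv.Perm (Fin n))
    (T : YTableau lam) : tabloidRep n τ (polytabloid T) = polytabloid (T.trans τ) := by
  classical
  unfold polytabloid
  rw [map_sum]
  refine Finset.sum_bij' (fun σ _ => τ * σ * τ⁻¹) (fun σ _ => τ⁻¹ * σ * τ) ?_ ?_ ?_ ?_ ?_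
  · intro σ hσ
    simp only [Finset.mem_filter, Finset.mem_univ, true_and] at hσ ⊢
    intro v
    have := hσ (τ⁻¹ v)
    simpa [YTableau.colOf] using this
  · intro σ hσ
    simp only [Finset.mem_filter, Finset.mem_univ, true_and] at hσ ⊢
    intro v
    have := hσ (τ v)
    simpa [YTableau.colOf] using this
  · intro σ _
    group
  · intro σ _
    group
  · intro σ _
    have h1 : (T.rowOf ∘ ⇑(σ⁻¹)) ∘ ⇑(τ⁻¹)
        = YTableau.rowOf (lam := lam) (T.trans τ) ∘ ⇑((τ * σ * τ⁻¹)⁻¹) := by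
      funext v
      simp [YTableau.rowOf, mul_assoc]
    have h2 : Equiv.Perm.sign (τ * σ * τ⁻¹) = Equiv.Perm.sign σ := by
      rw [map_mul, map_mul, map_inv, mul_right_comm, mul_inv_cancel, one_mul]
    change Finsupp.lmapDomain ℂ ℂ _ _ = _
    rw [Finsupp.lmapDomain_apply, Finsupp.mapDomain_single, h1, h2]

/-- The Specht module `S^lam`: the span of all polytabloids of shape `lam`. -/
def spechtModule {n : ℕ} (lam : n.Partition) : Submodule ℂ ((Fin n → ℕ) →₀ ℂ) :=
  Submodule.span ℂ (Set.range (polytabloid (lam := lam)))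

theorem tabloidRep_mem_spechtModule {n : ℕ} (lam : n.Partition) (τ : Equiv.Perm (Fin n)) :
    ∀ v ∈ spechtModule lam, tabloidRep n τ v ∈ spechtModule lam := by
  intro v hv
  have hle : spechtModule lam ≤ (spechtModule lam).comap (tabloidRep n τ) := by
    unfold spechtModule
    rw [Submodule.span_le]
    rintro _ ⟨T, rfl⟩
    change tabloidRep n τ (polytabloid T) ∈ Submodule.span ℂ _
    rw [tabloidRep_polytabloid]
    exact Submodule.subset_span ⟨_, rfl⟩
  exact hle hv

/-- The irreducible character `χ_lam` of `𝔖ₙ` over `ℂ` indexed by the partition `lam`: the trace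
of the action of `σ` on the Specht module `S^lam` (which is finite-dimensional). -/
def irrChar {n : ℕ} (lam : n.Partition) (σ : Equiv.Perm (Fin n)) : ℂ :=
  LinearMap.trace ℂ (spechtModule lam)
    ((tabloidRep n σ).restrict (tabloidRep_mem_spechtModule lam σ))

/-! ### Immanants and Laplacian immanantal polynomials -/

/-- The immanant `imm_lam(A) = ∑_ψ χ_lam(ψ) ∏ᵢ A i (ψ i)` of an `n × n` matrix over a
commutative `ℂ`-algebra. -/
def immanant {n : ℕ} (lam : n.Partition) {R : Type*} [CommRing R] [Algebra ℂ R]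
    (A : Matrix (Fin n) (Fin n) R) : R :=
  ∑ ψ : Equiv.Perm (Fin n), irrChar lam ψ • ∏ i, A i (ψ i)

/-- The immanantal polynomial `φ_lam(A, x) = imm_lam(xI - A)`. -/
def immanantalPolynomial {n : ℕ} (lam : n.Partition) (A : Matrix (Fin n) (Fin n) ℂ) : ℂ[X] :=
  immanant lam (Matrix.charmatrix A)

/-- `b_{lam,r}(A)` for `0 ≤ r ≤ n`: the coefficient of `(-1)^r x^(n-r)` in `φ_lam(A, x)`. -/
def immanantalCoeff {n : ℕ} (lam : n.Partition) (r : ℕ) (A : Matrix (Fin n) (Fin n) ℂ) : ℂ :=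
  (-1) ^ r * (immanantalPolynomial lam A).coeff (n - r)

/-! ### Vertex orientations -/

/-- `O` is a `B`-orientation in `G`: each vertex `v ∈ B` is assigned an arrow `v → O v` along an
edge of `G` at `v`, and the vertices outside `B` get no arrow (`O v = none`). -/
def IsBOrientation {n : ℕ} (G : SimpleGraph (Fin n)) (B : Finset (Fin n))
    (O : Fin n → Option (Fin n)) : Prop :=
  (∀ v, (O v).isSome ↔ v ∈ B) ∧ ∀ v u, O v = some u → G.Adj v u

/-- `c` is a directed cycle of `O`: a cyclic permutation `v₁ ↦ v₂ ↦ ⋯ ↦ vᵢ ↦ v₁` of `i ≥ 2`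
distinct vertices (its support), each of which has its arrow pointing to the next one.
For `i = 2` this is an edge with two arrows on it. -/
def IsDirectedCycle {n : ℕ} (O : Fin n → Option (Fin n)) (c : Equiv.Perm (Fin n)) : Prop :=
  c.IsCycle ∧ ∀ v ∈ c.support, O v = some (c v)

open Classical in
/-- The number of directed cycles of length `i` in `O` (bidirected edges if `i = 2`). -/
def numDirectedCycles {n : ℕ} (O : Fin n → Option (Fin n)) (i : ℕ) : ℕ :=
  (Finset.univ.filter fun c : Equiv.Perm (Fin n) =>
    IsDirectedCycle O c ∧ c.support.card = i).card

/-- `O` has type `mu = (1^{n₁}, 2^{n₂}, …)`: for every `i ≥ 2`, the multiplicity `nᵢ` of `i` in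
`mu` is the number of directed `i`-cycles of `O`. Since `mu` is a partition of `n`, the
multiplicity `n₁` is then the number of vertices that lie on no directed cycle. -/
def HasType {n : ℕ} (O : Fin n → Option (Fin n)) (mu : n.Partition) : Prop :=
  ∀ i, 2 ≤ i → mu.parts.count i = numDirectedCycles O i

open Classical in
/-- `O_{G,r}(mu)`: all `B`-orientations of type `mu` in `G`, for all vertex sets `B` of size `r`. -/
def orientations {n : ℕ} (G : SimpleGraph (Fin n)) (r : ℕ) (mu : n.Partition) :
    Finset (Fin n → Option (Fin n)) :=
  Finset.univ.filter fun O =>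
    (∃ B : Finset (Fin n), B.card = r ∧ IsBOrientation G B O) ∧ HasType O mu

/-- `a_{G,r}(mu) = |O_{G,r}(mu)|`. -/
def numOrientations {n : ℕ} (G : SimpleGraph (Fin n)) (r : ℕ) (mu : n.Partition) : ℕ :=
  (orientations G r mu).card

/-! ### The generalized graph shift -/

/-- The graph obtained from `G` by moving all neighbours of `y` except `w` to the vertex `x`:
every edge `yu` with `u ≠ w` is replaced by the edge `xu`. -/
def moveNeighbors {V : Type*} (G : SimpleGraph V) (x y w : V) : SimpleGraph V :=
  SimpleGraph.fromEdgeSet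
    ((G.edgeSet \ {e | ∃ u, G.Adj y u ∧ u ≠ w ∧ e = s(y, u)}) ∪
      {e | ∃ u, G.Adj y u ∧ u ≠ w ∧ e = s(x, u)})

/-- `G₂ = GGS(G₁)`: there are distinct vertices `x` (the recipient) and `y` (the donor) of `G₁`,
not contained in one cycle of `G₁`, and a path from `x` to `y` all of whose interior vertices have
degree `2`, such that `G₂` is obtained from `G₁` by moving all neighbours of `y`, except the one on
the path, to `x`. -/
def IsGGS {V : Type*} [Fintype V] (G₁ G₂ : SimpleGraph V) [DecidableRel G₁.Adj] : Prop :=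
  ∃ (x y : V) (p : G₁.Walk x y), x ≠ y ∧ p.IsPath ∧
    (∀ v ∈ p.support, v ≠ x → v ≠ y → G₁.degree v = 2) ∧
    (∀ (z : V) (c : G₁.Walk z z), c.IsCycle → ¬ (x ∈ c.support ∧ y ∈ c.support)) ∧
    G₂ = moveNeighbors G₁ x y p.penultimate

end

/-! The inequality between numbers of orientations does not need bipartiteness. Let `P` be the path
and `S` the set of vertices beyond `y`; the shift detaches `S` from `y` and attaches it to `x`. An
orientation of the shifted graph is sent injectively to one of the original graph
(`ShiftConfig.transfer`). If `x` has no arrow into `S`, every arrow from `S` to `x` is redirected to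
`y`; no arrow enters `S`, so these arrows lie on no directed cycle. If `x` has an arrow into `S`,
everything on `P ∪ S` is reflected along the path. Only `x` can have neighbours outside `P ∪ S`, and
its single arrow is already spent, so no directed cycle crosses the boundary and the cycles inside
are merely conjugated. The image reveals the case: `y` points into `S` exactly when `x` did.

For the coefficients, choosing one summand of each factor in the product over the rows of `xI - L`
amounts to choosing an orientation. In a bipartite graph the signs cancel, so `b_{lam,r}` is the
sum, over orientations `O` with `r` arrows, of a weight `w(O)`: the sum of the character over all
products of directed cycles of `O` (`immanantalCoeff_lapMatrix`). The weight depends only on the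
type, so it remains to see `w(O) ≥ 0` (`orientationWeight_nonneg`). Let `E` be the set of these
products and `A = ∑ ρ(ψ)` over `ψ ∈ E`, with `ρ` the Specht representation, unitary for the standard
form. Then `tr(A A*) ≥ 0`. For `ψ, φ ∈ E` the cycles common to both cancel in `ψ φ⁻¹`, which has the
cycle type of the product over the symmetric difference; hence `tr(A A*) = |E| w(O)`. -/

noncomputable section

/-! ### Transferring orientations across the shift -/

/-- A recipient `x`, a donor `y` with path neighbour `w`, the vertex set `P` of the path from `x`
to `y`, the set `S` of vertices beyond `y`, and the reversal `τ` of the path. -/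
structure ShiftConfig {V : Type*} (G : SimpleGraph V) (x y w : V) (P S : Set V)
    (τ : Equiv.Perm V) : Prop where
  ne : x ≠ y
  x_mem : x ∈ P
  y_mem : y ∈ P
  w_mem : w ∈ P
  notMem_of_mem : ∀ v ∈ S, v ∉ P
  involutive : ∀ v, τ (τ v) = v
  map_x : τ x = y
  map_mem : ∀ v ∈ P, τ v ∈ P
  map_of_notMem : ∀ v, v ∉ P → τ v = v
  mem_of_adj_y : ∀ u, G.Adj y u → u ≠ w → u ∈ S
  boundary : ∀ a b, a ∈ S → b ∉ S → G.Adj a b → b = y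
  interior : ∀ v ∈ P, v ≠ x → v ≠ y → ∀ u, G.Adj v u → u ∈ P
  adj_map : ∀ a ∈ P, ∀ b ∈ P, G.Adj a b → G.Adj (τ a) (τ b)

/-- If nothing entered `S`, then `c⁻¹` would map the finite set `S` into itself, hence onto itself.
A cycle that leaves a set must therefore also enter it. -/
theorem exists_perm_mem_of_exists_perm_notMem {V : Type*} [Finite V] (c : Equiv.Perm V)
    {S : Set V} {v : V} (hv : v ∈ S) (hcv : c v ∉ S) : ∃ u, u ∉ S ∧ c u ∈ S := by
  by_contra! h
  have hsub : ∀ u, c u ∈ S → u ∈ S := fun u hu => by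
    by_contra hu'
    exact h u hu' hu
  have h1 : c.symm '' S ⊆ S := by
    rintro _ ⟨u, hu, rfl⟩
    exact hsub _ (by simpa using hu)
  have h2 : c.symm '' S = S :=
    Set.eq_of_subset_of_ncard_le h1 (Set.ncard_image_of_injective S c.symm.injective).ge
      (Set.toFinite S)
  have h3 : v ∈ c.symm '' S := h2.symm ▸ hv
  obtain ⟨u, hu, rfl⟩ := h3
  exact hcv (by simpa using hu)

namespace ShiftConfig

section

variable {V : Type*} {G : SimpleGraph V} {x y w : V} {P S : Set V} {τ : Equiv.Perm V}

theorem map_y (h : ShiftConfig G x y w P S τ) : τ y = x := by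
  rw [← h.map_x, h.involutive]

theorem map_of_mem (h : ShiftConfig G x y w P S τ) {v : V} (hv : v ∈ S) : τ v = v :=
  h.map_of_notMem v (h.notMem_of_mem v hv)

theorem x_notMem (h : ShiftConfig G x y w P S τ) : x ∉ S :=
  fun hx => h.notMem_of_mem x hx h.x_mem

theorem y_notMem (h : ShiftConfig G x y w P S τ) : y ∉ S :=
  fun hx => h.notMem_of_mem y hx h.y_mem

theorem ne_w_iff (h : ShiftConfig G x y w P S τ) {u : V} (hu : G.Adj y u) : u ≠ w ↔ u ∈ S :=
  ⟨h.mem_of_adj_y u hu, fun hS hw => h.notMem_of_mem u hS (hw ▸ h.w_mem)⟩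

theorem moveNeighbors_adj (h : ShiftConfig G x y w P S τ) (a b : V) :
    (moveNeighbors G x y w).Adj a b ↔
      (G.Adj a b ∧ ¬(a = y ∧ b ∈ S) ∧ ¬(b = y ∧ a ∈ S)) ∨
        (a = x ∧ b ∈ S ∧ G.Adj y b) ∨ (b = x ∧ a ∈ S ∧ G.Adj y a) := by
  have key : ∀ u, G.Adj y u ∧ u ≠ w ↔ G.Adj y u ∧ u ∈ S := fun u =>
    and_congr_right fun hu => h.ne_w_iff hu
  simp only [moveNeighbors, SimpleGraph.fromEdgeSet_adj, Set.mem_union, Set.mem_sdiff,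
    SimpleGraph.mem_edgeSet, Set.mem_ofPred_eq, ← and_assoc, key, Sym2.eq_iff]
  constructor
  · rintro ⟨⟨h1, h2⟩ | ⟨u, ⟨h1, h2⟩, ⟨rfl, rfl⟩ | ⟨rfl, rfl⟩⟩, h3⟩
    · refine Or.inl ⟨⟨h1, ?_⟩, ?_⟩
      · rintro ⟨rfl, hb⟩
        exact h2 ⟨b, ⟨h1, hb⟩, by simp⟩
      · rintro ⟨rfl, hb⟩
        exact h2 ⟨a, ⟨h1.symm, hb⟩, by simp⟩
    · exact Or.inr (Or.inl ⟨⟨rfl, h2⟩, h1⟩)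
    · exact Or.inr (Or.inr ⟨⟨rfl, h2⟩, h1⟩)
  · rintro (⟨⟨h1, h2⟩, h3⟩ | ⟨⟨rfl, h2⟩, h3⟩ | ⟨⟨rfl, h2⟩, h3⟩)
    · refine ⟨Or.inl ⟨h1, ?_⟩, h1.ne⟩
      rintro ⟨u, ⟨h4, h5⟩, ⟨rfl, rfl⟩ | ⟨rfl, rfl⟩⟩
      · exact h2 ⟨rfl, h5⟩
      · exact h3 ⟨rfl, h5⟩
    · exact ⟨Or.inr ⟨b, ⟨h3, h2⟩, by simp⟩, fun hh => h.x_notMem (hh ▸ h2)⟩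
    · exact ⟨Or.inr ⟨a, ⟨h3, h2⟩, by simp⟩, fun hh => h.x_notMem (hh ▸ h2)⟩

/-- In the shifted graph, only `x` joins `S` to the rest. -/
theorem eq_x_of_moveNeighbors_adj_mem (h : ShiftConfig G x y w P S τ) {a b : V} (ha : a ∉ S)
    (hb : b ∈ S) (hab : (moveNeighbors G x y w).Adj a b) : a = x ∧ G.Adj y b := by
  rcases (h.moveNeighbors_adj a b).1 hab with ⟨h1, h2, -⟩ | ⟨h1, -, h2⟩ | ⟨-, h1, -⟩
  · exact absurd ⟨h.boundary b a hb ha h1.symm, hb⟩ h2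
  · exact ⟨h1, h2⟩
  · exact absurd h1 ha

theorem adj_of_moveNeighbors_adj (h : ShiftConfig G x y w P S τ) {a b : V} (hax : a ∈ S → b ≠ x)
    (hbx : b ∈ S → a ≠ x) (hab : (moveNeighbors G x y w).Adj a b) : G.Adj a b := by
  rcases (h.moveNeighbors_adj a b).1 hab with ⟨h1, -⟩ | ⟨h1, h2, -⟩ | ⟨h1, h2, -⟩
  · exact h1
  · exact absurd h1 (hbx h2)
  · exact absurd h1 (hax h2)

/-- In `G`, only `x` joins `P ∪ S` to the rest. -/
theorem eq_x_of_adj (h : ShiftConfig G x y w P S τ) {a b : V} (ha : a ∈ P ∪ S) (hb : b ∉ P ∪ S)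
    (hab : G.Adj a b) : a = x := by
  simp only [Set.mem_union, not_or] at hb
  rcases ha with ha | ha
  · by_contra hax
    by_cases hay : a = y
    · subst hay
      have hbw : b ≠ w := fun hh => hb.1 (hh ▸ h.w_mem)
      exact hb.2 (h.mem_of_adj_y b hab hbw)
    · exact hb.1 (h.interior a ha hax hay b hab)
  · exact absurd (h.boundary a b ha hb.2 hab ▸ h.y_mem) hb.1

theorem eq_x_of_moveNeighbors_adj (h : ShiftConfig G x y w P S τ) {a b : V} (ha : a ∈ P ∪ S)
    (hb : b ∉ P ∪ S) (hab : (moveNeighbors G x y w).Adj a b) : a = x := by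
  rcases (h.moveNeighbors_adj a b).1 hab with ⟨h1, -⟩ | ⟨h1, -⟩ | ⟨h1, -⟩
  · exact h.eq_x_of_adj ha hb h1
  · exact h1
  · exact absurd (Or.inl (h1 ▸ h.x_mem)) hb

open Classical in
/-- The map from the orientations of the shifted graph to those of the original graph. -/
def transfer (x : V) (P S : Set V) (τ : Equiv.Perm V) (O : V → Option V) (v : V) : Option V :=
  if v ∈ S then (O v).map τ
  else if v ∈ P ∧ ∃ u ∈ S, O x = some u then (O (τ v)).map τ
  else O v

theorem transfer_of_mem {O : V → Option V} {v : V} (hv : v ∈ S) :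
    transfer x P S τ O v = (O v).map τ := if_pos hv

theorem transfer_of_mem_path {O : V → Option V} {v : V} (hS : v ∉ S) (hv : v ∈ P)
    (hO : ∃ u ∈ S, O x = some u) : transfer x P S τ O v = (O (τ v)).map τ := by
  rw [transfer, if_neg hS, if_pos ⟨hv, hO⟩]

theorem transfer_of_not {O : V → Option V} {v : V} (hS : v ∉ S)
    (hO : ¬(v ∈ P ∧ ∃ u ∈ S, O x = some u)) : transfer x P S τ O v = O v := by
  rw [transfer, if_neg hS, if_neg hO]

/-- The new edges join `x` to `S`. Arrows from `S` to `x` are redirected to `y`. An arrow from `x`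
into `S` triggers the reflection and becomes an arrow from `y`; the other arrows on `P` then stay in
`P`, since only `x` could leave `P ∪ S`, and reversing the path preserves adjacency there. -/
theorem transfer_adj (h : ShiftConfig G x y w P S τ) {O : V → Option V}
    (hO : ∀ v u, O v = some u → (moveNeighbors G x y w).Adj v u) (v u : V)
    (huv : transfer x P S τ O v = some u) : G.Adj v u := by
  by_cases hv : v ∈ S
  · rw [transfer_of_mem hv, Option.map_eq_some_iff] at huv
    obtain ⟨z, hz, rfl⟩ := huv
    have hz' := hO v z hz
    by_cases hzS : z ∈ S
    · rw [h.map_of_mem hzS]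
      exact h.adj_of_moveNeighbors_adj (fun _ hh => h.x_notMem (hh ▸ hzS))
        (fun _ hh => h.x_notMem (hh ▸ hv)) hz'
    · obtain ⟨rfl, h2⟩ := h.eq_x_of_moveNeighbors_adj_mem hzS hv hz'.symm
      rw [h.map_x]
      exact h2.symm
  · by_cases hc : v ∈ P ∧ ∃ u ∈ S, O x = some u
    · rw [transfer_of_mem_path hv hc.1 hc.2, Option.map_eq_some_iff] at huv
      obtain ⟨z, hz, rfl⟩ := huv
      have hz' := hO _ z hz
      have hτP := h.map_mem v hc.1
      have hτS : τ v ∉ S := fun hh => h.notMem_of_mem _ hh hτP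
      by_cases hzS : z ∈ S
      · obtain ⟨h1, h2⟩ := h.eq_x_of_moveNeighbors_adj_mem hτS hzS hz'
        rw [h.map_of_mem hzS, ← h.involutive v, h1, h.map_x]
        exact h2
      · have hτx : τ v ≠ x := by
          intro hh
          obtain ⟨u, hu, hu'⟩ := hc.2
          rw [hh, hu'] at hz
          exact hzS (Option.some.inj hz ▸ hu)
        have hzP : z ∈ P := by
          by_contra hzP
          exact hτx (h.eq_x_of_moveNeighbors_adj (Or.inl hτP) (by simp [hzP, hzS]) hz')
        have := h.adj_map _ hτP _ hzP (h.adj_of_moveNeighbors_adj (fun hh => absurd hh hτS)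
          (fun hh => absurd hh hzS) hz')
        rwa [h.involutive] at this
    · rw [transfer_of_not hv hc] at huv
      refine h.adj_of_moveNeighbors_adj (fun hh => absurd hh hv) (fun hu hx => ?_) (hO v u huv)
      subst hx
      exact hc ⟨h.x_mem, u, hu, huv⟩

/-- Recovers from the image which of the two cases was applied; injectivity rests on this. In the
shifted graph `y` has no neighbour in `S`, so such an arrow can only come from the reflection. -/
theorem transfer_y_mem_iff (h : ShiftConfig G x y w P S τ) {O : V → Option V}
    (hO : ∀ v u, O v = some u → (moveNeighbors G x y w).Adj v u) :
    (∃ u ∈ S, transfer x P S τ O y = some u) ↔ ∃ u ∈ S, O x = some u := by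
  constructor
  · rintro ⟨u, hu, hu'⟩
    by_contra hc
    rw [transfer_of_not h.y_notMem (fun hh => hc hh.2)] at hu'
    exact h.ne (h.eq_x_of_moveNeighbors_adj_mem h.y_notMem hu (hO _ _ hu')).1.symm
  · rintro ⟨u, hu, hu'⟩
    refine ⟨u, hu, ?_⟩
    rw [transfer_of_mem_path h.y_notMem h.y_mem ⟨u, hu, hu'⟩, h.map_y, hu', Option.map_some,
      h.map_of_mem hu]

theorem transfer_injOn (h : ShiftConfig G x y w P S τ) :
    Set.InjOn (transfer x P S τ) {O | ∀ v u, O v = some u → (moveNeighbors G x y w).Adj v u} := by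
  intro O hO O' hO' heq
  have hmap : Function.Injective (Option.map τ) := Option.map_injective τ.injective
  have hiff : (∃ u ∈ S, O x = some u) ↔ ∃ u ∈ S, O' x = some u := by
    rw [← h.transfer_y_mem_iff hO, ← h.transfer_y_mem_iff hO', heq]
  funext v
  have hv := congrFun heq v
  by_cases hvS : v ∈ S
  · rw [transfer_of_mem hvS, transfer_of_mem hvS] at hv
    exact hmap hv
  · by_cases hc : v ∈ P ∧ ∃ u ∈ S, O x = some u
    · have hτP := h.map_mem v hc.1
      have hτS : τ v ∉ S := fun hh => h.notMem_of_mem _ hh hτP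
      have hτ := congrFun heq (τ v)
      rw [transfer_of_mem_path hτS hτP hc.2, transfer_of_mem_path hτS hτP (hiff.1 hc.2),
        h.involutive] at hτ
      exact hmap hτ
    · rwa [transfer_of_not hvS hc, transfer_of_not hvS (fun hh => hc ⟨hh.1, hiff.2 hh.2⟩)] at hv

theorem exists_isSome_transfer (h : ShiftConfig G x y w P S τ) (O : V → Option V) :
    ∃ ρ : Equiv.Perm V, ∀ v, (transfer x P S τ O v).isSome = (O (ρ v)).isSome := by
  by_cases hc : ∃ u ∈ S, O x = some u
  · refine ⟨τ, fun v => ?_⟩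
    by_cases hvS : v ∈ S
    · rw [transfer_of_mem hvS, h.map_of_mem hvS, Option.isSome_map]
    · by_cases hP : v ∈ P
      · rw [transfer_of_mem_path hvS hP hc, Option.isSome_map]
      · rw [transfer_of_not hvS (fun hh => hP hh.1), h.map_of_notMem v hP]
  · refine ⟨1, fun v => ?_⟩
    by_cases hvS : v ∈ S
    · rw [transfer_of_mem hvS, Option.isSome_map]; rfl
    · rw [transfer_of_not hvS (fun hh => hc hh.2)]; rfl

end

/-! ### Directed cycles under the transfer -/

section

variable {n : ℕ} {G : SimpleGraph (Fin n)} {x y w : Fin n} {P S : Set (Fin n)}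
  {τ : Equiv.Perm (Fin n)}

theorem mem_support_of_ne {c : Equiv.Perm (Fin n)} {T : Set (Fin n)} {u : Fin n} (hu : u ∉ T)
    (hcu : c u ∈ T) : u ∈ c.support := by
  rw [Equiv.Perm.mem_support]
  intro hh
  rw [hh] at hcu
  exact hu hcu

/-- Only arrows from `S` to `x` are altered. No arrow enters `S`, before or after, so no directed
cycle leaves `S` and the altered arrows are on none. -/
theorem isDirectedCycle_transfer_of_not (h : ShiftConfig G x y w P S τ)
    {O : Fin n → Option (Fin n)}
    (hO : ∀ v u, O v = some u → (moveNeighbors G x y w).Adj v u)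
    (hc : ¬∃ u ∈ S, O x = some u) (c : Equiv.Perm (Fin n)) :
    IsDirectedCycle (transfer x P S τ O) c ↔ IsDirectedCycle O c := by
  have hout : ∀ v, v ∉ S → transfer x P S τ O v = O v :=
    fun v hv => transfer_of_not hv (fun hh => hc hh.2)
  have hno : ∀ u, u ∉ S → ∀ z ∈ S, O u ≠ some z := by
    intro u hu z hz huz
    obtain ⟨rfl, -⟩ := h.eq_x_of_moveNeighbors_adj_mem hu hz (hO _ _ huz)
    exact hc ⟨z, hz, huz⟩
  refine and_congr_right fun _ => ⟨fun hd v hv => ?_, fun hd v hv => ?_⟩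
  · have stay : ∀ v ∈ S, c v ∈ S := by
      intro v hvS
      by_contra hcv
      obtain ⟨u, hu, hcu⟩ := exists_perm_mem_of_exists_perm_notMem c hvS hcv
      exact hno u hu _ hcu (hout u hu ▸ hd u (mem_support_of_ne hu hcu))
    by_cases hvS : v ∈ S
    · have h1 := hd v hv
      rw [transfer_of_mem hvS, Option.map_eq_some_iff] at h1
      obtain ⟨z, hz, hz'⟩ := h1
      rw [hz, ← h.involutive z, hz', h.map_of_mem (stay v hvS)]
    · rw [← hout v hvS]
      exact hd v hv
  · have stay : ∀ v ∈ S, c v ∈ S := by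
      intro v hvS
      by_contra hcv
      obtain ⟨u, hu, hcu⟩ := exists_perm_mem_of_exists_perm_notMem c hvS hcv
      exact hno u hu _ hcu (hd u (mem_support_of_ne hu hcu))
    by_cases hvS : v ∈ S
    · rw [transfer_of_mem hvS, hd v hv, Option.map_some, h.map_of_mem (stay v hvS)]
    · rw [hout v hvS]
      exact hd v hv

/-- No arrow leaves `P ∪ S`, before or after, so each directed cycle lies inside, where it is
reflected, or outside, where `τ` is the identity. -/
theorem isDirectedCycle_transfer_conj (h : ShiftConfig G x y w P S τ)
    {O : Fin n → Option (Fin n)}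
    (hO : ∀ v u, O v = some u → (moveNeighbors G x y w).Adj v u)
    (hc : ∃ u ∈ S, O x = some u) (c : Equiv.Perm (Fin n)) :
    IsDirectedCycle (transfer x P S τ O) (τ * c * τ⁻¹) ↔ IsDirectedCycle O c := by
  have hcyc : (τ * c * τ⁻¹).IsCycle ↔ c.IsCycle :=
    ⟨fun hh => by simpa [mul_assoc] using hh.conj (g := τ⁻¹), fun hh => hh.conj⟩
  have hin : ∀ v ∈ P ∪ S, transfer x P S τ O (τ v) = (O v).map τ := by
    intro v hv
    by_cases hvS : v ∈ S
    · rw [h.map_of_mem hvS, transfer_of_mem hvS]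
    · have hvP : v ∈ P := hv.resolve_right hvS
      have hτP := h.map_mem v hvP
      rw [transfer_of_mem_path (fun hh => h.notMem_of_mem _ hh hτP) hτP hc, h.involutive]
  have hout : ∀ v, v ∉ P ∪ S → transfer x P S τ O v = O v := by
    intro v hv
    simp only [Set.mem_union, not_or] at hv
    exact transfer_of_not hv.2 (fun hh => hv.1 hh.1)
  have hτout : ∀ v, v ∉ P ∪ S → τ v = v := fun v hv =>
    h.map_of_notMem v (fun hh => hv (Or.inl hh))
  have hτmem : ∀ v, τ v ∈ P ∪ S → v ∈ P ∪ S := by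
    intro v hv
    by_contra hv'
    rw [hτout v hv'] at hv
    exact hv' hv
  have hno : ∀ u ∈ P ∪ S, ∀ z, z ∉ P ∪ S → O u ≠ some z := by
    intro u hu z hz huz
    have := h.eq_x_of_moveNeighbors_adj hu hz (hO _ _ huz)
    subst this
    obtain ⟨a, ha, ha'⟩ := hc
    rw [ha', Option.some.injEq] at huz
    exact hz (Or.inr (huz ▸ ha))
  -- After the transfer, too, only `x` could point outside; its arrow is the reflection of the arrow
  -- at `y`, which stays in `P ∪ S` by `hno`.
  have hno' : ∀ u ∈ P ∪ S, ∀ z, z ∉ P ∪ S → transfer x P S τ O u ≠ some z := by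
    intro u hu z hz huz
    rw [h.eq_x_of_adj hu hz (h.transfer_adj hO u z huz), ← h.map_y] at huz
    nth_rw 1 [h.map_y] at huz
    rw [hin y (Or.inl h.y_mem), Option.map_eq_some_iff] at huz
    obtain ⟨b, hb, rfl⟩ := huz
    rw [hτout b (fun hh => ?_)] at hz
    · exact hno y (Or.inl h.y_mem) b hz hb
    · rcases hh with hh | hh
      · exact hz (Or.inl (h.map_mem b hh))
      · exact hz (Or.inr ((h.map_of_mem hh).symm ▸ hh))
  refine and_congr hcyc ⟨fun hd v hv => ?_, fun hd v' hv' => ?_⟩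
  · have hsupp : ∀ v ∈ c.support, transfer x P S τ O (τ v) = some (τ (c v)) := by
      intro v hv
      have := hd (τ v) (by simpa [Equiv.Perm.mem_support] using hv)
      simpa using this
    have stay : ∀ v, v ∉ P ∪ S → c v ∉ P ∪ S := by
      intro v hv
      by_contra hcv
      obtain ⟨u, hu, hcu⟩ := exists_perm_mem_of_exists_perm_notMem c (S := (P ∪ S)ᶜ) hv
        (fun hh => hh hcv)
      have hu' : u ∈ P ∪ S := not_not.1 hu
      have := hsupp u (mem_support_of_ne hu hcu)
      refine hno' (τ u) ?_ _ ?_ this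
      · exact hτmem _ ((h.involutive u).symm ▸ hu')
      · rw [hτout _ hcu]; exact hcu
    have h1 := hsupp v hv
    by_cases hvS : v ∈ P ∪ S
    · rw [hin v hvS, Option.map_eq_some_iff] at h1
      obtain ⟨z, hz, hz'⟩ := h1
      rw [hz, τ.injective hz']
    · rwa [hτout v hvS, hτout _ (stay v hvS), hout v hvS] at h1
  · obtain ⟨v, rfl⟩ := τ.surjective v'
    have hv : v ∈ c.support := by simpa [Equiv.Perm.mem_support] using hv'
    have stay : ∀ v, v ∉ P ∪ S → c v ∉ P ∪ S := by
      intro v hv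
      by_contra hcv
      obtain ⟨u, hu, hcu⟩ := exists_perm_mem_of_exists_perm_notMem c (S := (P ∪ S)ᶜ) hv
        (fun hh => hh hcv)
      exact hno u (not_not.1 hu) _ hcu (hd u (mem_support_of_ne hu hcu))
    have hgoal : (τ * c * τ⁻¹) (τ v) = τ (c v) := by simp
    rw [hgoal]
    by_cases hvS : v ∈ P ∪ S
    · rw [hin v hvS, hd v hv, Option.map_some]
    · rw [hτout v hvS, hout v hvS, hτout _ (stay v hvS), hd v hv]

theorem numDirectedCycles_transfer (h : ShiftConfig G x y w P S τ)
    {O : Fin n → Option (Fin n)}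
    (hO : ∀ v u, O v = some u → (moveNeighbors G x y w).Adj v u) (i : ℕ) :
    numDirectedCycles (transfer x P S τ O) i = numDirectedCycles O i := by
  classical
  unfold numDirectedCycles
  by_cases hc : ∃ u ∈ S, O x = some u
  · refine (Finset.card_equiv (MulAut.conj τ).toEquiv fun c => ?_).symm
    simp only [Finset.mem_filter, Finset.mem_univ, true_and, MulEquiv.toEquiv_eq_coe,
      MulEquiv.coe_toEquiv, MulAut.conj_apply, h.isDirectedCycle_transfer_conj hO hc,
      Equiv.Perm.card_support_conj]
  · simp only [h.isDirectedCycle_transfer_of_not hO hc]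

theorem transfer_mem_orientations (h : ShiftConfig G x y w P S τ) {r : ℕ} {mu : n.Partition}
    {O : Fin n → Option (Fin n)} (hO : O ∈ orientations (moveNeighbors G x y w) r mu) :
    transfer x P S τ O ∈ orientations G r mu := by
  classical
  simp only [orientations, Finset.mem_filter, Finset.mem_univ, true_and] at hO ⊢
  obtain ⟨⟨B, hB, hB1, hB2⟩, hmu⟩ := hO
  obtain ⟨ρ, hρ⟩ := h.exists_isSome_transfer O
  refine ⟨⟨B.map ρ.symm.toEmbedding, by rw [Finset.card_map, hB], fun v => ?_,
    h.transfer_adj hB2⟩, fun i hi => ?_⟩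
  · rw [hρ, hB1, Finset.mem_map_equiv, Equiv.symm_symm]
  · rw [hmu i hi, h.numDirectedCycles_transfer hB2]

theorem numOrientations_le (h : ShiftConfig G x y w P S τ) (r : ℕ) (mu : n.Partition) :
    numOrientations (moveNeighbors G x y w) r mu ≤ numOrientations G r mu := by
  refine Finset.card_le_card_of_injOn (transfer x P S τ)
    (fun O hO => h.transfer_mem_orientations hO) (h.transfer_injOn.mono fun O hO => ?_)
  simp only [orientations, Finset.coe_filter, Finset.mem_univ, true_and, Set.mem_ofPred_eq] at hO
  obtain ⟨⟨B, -, -, hB⟩, -⟩ := hO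
  exact hB

end

end ShiftConfig

/-! ### Path reversal and the structure around the shifted path -/

namespace SimpleGraph.Walk

variable {V : Type*} {G : SimpleGraph V} {x y : V}

theorem IsPath.eq_getVert_iff {p : G.Walk x y} (hp : p.IsPath) {i j : ℕ} (hi : i ≤ p.length)
    (hj : j ≤ p.length) : p.getVert i = p.getVert j ↔ i = j :=
  hp.getVert_injOn.eq_iff hi hj

open Classical in
/-- The reversal of a walk as a map on vertices, the identity off the walk. -/
def reflect (p : G.Walk x y) (v : V) : V :=
  if v ∈ p.support then p.getVert (p.length - p.support.idxOf v) else v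

theorem reflect_of_notMem (p : G.Walk x y) {v : V} (hv : v ∉ p.support) : p.reflect v = v :=
  if_neg hv

theorem IsPath.reflect_getVert {p : G.Walk x y} (hp : p.IsPath) {i : ℕ} (hi : i ≤ p.length) :
    p.reflect (p.getVert i) = p.getVert (p.length - i) := by
  classical
  have hmem : p.getVert i ∈ p.support := p.getVert_mem_support i
  have hlt := List.idxOf_lt_length_of_mem hmem
  rw [length_support] at hlt
  have : p.support.idxOf (p.getVert i) = i :=
    (hp.eq_getVert_iff (by omega) hi).1 (p.getVert_support_idxOf hmem)
  unfold reflect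
  rw [if_pos hmem]
  convert rfl using 3
  convert this.symm

theorem IsPath.reflect_involutive {p : G.Walk x y} (hp : p.IsPath) :
    Function.Involutive p.reflect := by
  intro v
  by_cases hv : v ∈ p.support
  · obtain ⟨i, rfl, hi⟩ := mem_support_iff_exists_getVert.1 hv
    rw [hp.reflect_getVert hi, hp.reflect_getVert (by omega), Nat.sub_sub_self hi]
  · rw [p.reflect_of_notMem hv, p.reflect_of_notMem hv]

theorem IsPath.adj_getVert_of_degree_eq_two [Fintype V] [DecidableRel G.Adj] {p : G.Walk x y}
    (hp : p.IsPath) {i : ℕ} (hi : i + 1 < p.length) (hdeg : G.degree (p.getVert (i + 1)) = 2)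
    {u : V} (hu : G.Adj (p.getVert (i + 1)) u) : u = p.getVert i ∨ u = p.getVert (i + 2) := by
  classical
  have h1 : G.Adj (p.getVert (i + 1)) (p.getVert i) := (p.adj_getVert_succ (by omega)).symm
  have h2 : G.Adj (p.getVert (i + 1)) (p.getVert (i + 2)) := p.adj_getVert_succ (by omega)
  have hne : p.getVert i ≠ p.getVert (i + 2) := by
    rw [Ne, hp.eq_getVert_iff (by omega) (by omega)]; omega
  by_contra! hcon
  have hsub : {u, p.getVert i, p.getVert (i + 2)} ⊆ G.neighborFinset (p.getVert (i + 1)) := by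
    intro z hz
    simp only [Finset.mem_insert, Finset.mem_singleton] at hz
    rw [mem_neighborFinset]
    rcases hz with rfl | rfl | rfl <;> assumption
  have hcard := Finset.card_le_card hsub
  rw [card_neighborFinset_eq_degree, hdeg, Finset.card_eq_three.2
    ⟨_, _, _, hcon.1, hcon.2, hne, rfl⟩] at hcard
  omega

end SimpleGraph.Walk

open SimpleGraph Walk in
-- The cycle hypothesis separates `S` from `x` and excludes a chord `xy` of the path; the degree
-- condition keeps interior path vertices from having neighbours off the path.
theorem exists_shiftConfig {V : Type*} [Fintype V] {G : SimpleGraph V} [DecidableRel G.Adj]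
    {x y : V} (p : G.Walk x y) (hxy : x ≠ y) (hp : p.IsPath)
    (hdeg : ∀ v ∈ p.support, v ≠ x → v ≠ y → G.degree v = 2)
    (hcyc : ∀ (z : V) (c : G.Walk z z), c.IsCycle → ¬(x ∈ c.support ∧ y ∈ c.support)) :
    ∃ (P S : Set V) (τ : Equiv.Perm V), ShiftConfig G x y p.penultimate P S τ := by
  classical
  have hlen : 0 < p.length := by
    rw [Nat.pos_iff_ne_zero]
    intro h0
    exact hxy (eq_of_length_eq_zero h0)
  have hint : ∀ v ∈ p.support, v ≠ x → v ≠ y → ∃ i, i + 1 < p.length ∧ v = p.getVert (i + 1) ∧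
      ∀ u, G.Adj v u → u = p.getVert i ∨ u = p.getVert (i + 2) := by
    intro v hv hvx hvy
    obtain ⟨i, rfl, hi⟩ := mem_support_iff_exists_getVert.1 hv
    obtain _ | i := i
    · exact absurd p.getVert_zero hvx
    · have hi' : i + 1 < p.length := by
        refine lt_of_le_of_ne hi fun hh => hvy ?_
        rw [hh, getVert_length]
      exact ⟨i, hi', rfl, fun u hu => hp.adj_getVert_of_degree_eq_two hi' (hdeg _ hv hvx hvy) hu⟩
  -- no walk from `y` avoiding the path ends at a neighbour of `x`, except along the path
  have hnoclose : ∀ a, (∃ q : G.Walk y a, ∀ u ∈ q.support, u ∈ p.support → u = y) →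
      G.Adj a x → s(a, x) ∈ p.edges := by
    rintro a ⟨q, hq⟩ hax
    by_contra hedge
    have hq' : ∀ u ∈ q.bypass.support, u ∈ p.support → u = y :=
      fun u hu => hq u (q.support_bypass_subset_support hu)
    have hqp := q.bypass_isPath
    set q' := q.bypass
    have hpath : (p.append q').IsPath := by
      rw [isPath_def, support_append, List.nodup_append']
      refine ⟨hp.support_nodup, hqp.support_nodup.tail, ?_⟩
      intro u hu hu'
      have huy := hq' u (List.mem_of_mem_tail hu') hu
      subst huy
      have hnd := hqp.support_nodup
      rw [← cons_tail_support] at hnd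
      exact (List.nodup_cons.1 hnd).1 hu'
    -- The forbidden cycle: from `a` to `x`, along `p` to `y`, and along `q'` back to `a`.
    have hc : (Walk.cons hax (p.append q')).IsCycle := by
      rw [cons_isCycle_iff, edges_append, List.mem_append, not_or]
      refine ⟨hpath, hedge, fun hh => ?_⟩
      exact hxy (hq' x (q'.snd_mem_support_of_mem_edges hh) p.start_mem_support)
    refine hcyc a _ hc ⟨?_, ?_⟩
    · simp
    · simp
  -- With this choice `S` can be left only through `y`: an edge from `S` to `x` would contradict
  -- `hnoclose`, and a neighbour off the path extends the walk.
  let S : Set V := {v | v ∉ p.support ∧ ∃ q : G.Walk y v, ∀ u ∈ q.support, u ∈ p.support → u = y}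
  let τ : Equiv.Perm V := hp.reflect_involutive.toPerm
  have hτ : ∀ i ≤ p.length, τ (p.getVert i) = p.getVert (p.length - i) :=
    fun i hi => hp.reflect_getVert hi
  -- A path edge joining the two ends forces the path to be that single edge.
  have hedge_xy : s(y, x) ∈ p.edges → x = p.penultimate := by
    intro hh
    obtain ⟨i, hi, h1⟩ := (mk_mem_edges_iff_exists p).1 hh
    rw [Sym2.eq_iff] at h1
    rcases h1 with ⟨ha, hb⟩ | ⟨ha, hb⟩
    · rw [hp.getVert_eq_start_iff (by omega)] at hb
      omega
    · rw [hp.getVert_eq_end_iff (by omega)] at hb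
      rw [penultimate, ← hb, Nat.add_sub_cancel, ha]
  refine ⟨{v | v ∈ p.support}, S, τ, hxy, p.start_mem_support, p.end_mem_support,
    p.getVert_mem_support _, fun v hv => hv.1, fun v => hp.reflect_involutive v, ?_, ?_,
    fun v hv => p.reflect_of_notMem hv, ?_, ?_, ?_, ?_⟩
  · have := hτ 0 (by omega)
    simpa using this
  · intro v hv
    obtain ⟨i, rfl, hi⟩ := mem_support_iff_exists_getVert.1 hv
    rw [hτ i hi]
    exact p.getVert_mem_support _
  · intro u hyu huw
    have hu : u ∉ p.support := by
      intro hu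
      by_cases hux : u = x
      · subst hux
        refine huw (hedge_xy (hnoclose y ⟨Walk.nil, ?_⟩ hyu))
        intro z hz _
        simpa using hz
      · obtain ⟨i, hi, rfl, h2⟩ := hint u hu hux hyu.ne'
        rcases h2 y hyu.symm with h3 | h3
        · rw [eq_comm, hp.getVert_eq_end_iff (by omega)] at h3
          omega
        · rw [eq_comm, hp.getVert_eq_end_iff (by omega)] at h3
          refine huw ?_
          rw [penultimate]
          congr 1
          omega
    refine ⟨hu, Walk.cons hyu Walk.nil, ?_⟩
    intro z hz hzp
    simp only [support_cons, support_nil, List.mem_cons, List.not_mem_nil, or_false] at hz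
    rcases hz with rfl | rfl
    · rfl
    · exact absurd hzp hu
  · rintro a b ⟨ha, q, hq⟩ hb hab
    by_contra hby
    by_cases hbp : b ∈ p.support
    · by_cases hbx : b = x
      · subst hbx
        exact ha (p.fst_mem_support_of_mem_edges (hnoclose a ⟨q, hq⟩ hab))
      · obtain ⟨i, hi, rfl, h2⟩ := hint b hbp hbx hby
        rcases h2 a hab.symm with rfl | rfl <;> exact ha (p.getVert_mem_support _)
    · refine hb ⟨hbp, q.concat hab, fun u hu hup => ?_⟩
      rw [support_concat, List.mem_append, List.mem_singleton] at hu
      rcases hu with hu | rfl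
      · exact hq u hu hup
      · exact absurd hup hbp
  · intro v hv hvx hvy u hvu
    obtain ⟨i, hi, rfl, h2⟩ := hint v hv hvx hvy
    rcases h2 u hvu with rfl | rfl <;> exact p.getVert_mem_support _
  -- The path is induced: an edge at an interior vertex is a path edge by the degree condition, and
  -- an edge `xy` is one by `hnoclose`.
  · have hstep : ∀ a ∈ p.support, ∀ b ∈ p.support, G.Adj a b →
        ∃ i, i < p.length ∧ s(p.getVert i, p.getVert (i + 1)) = s(a, b) := by
      intro a ha b hb hab
      have hself : s(y, x) = s(a, b) → G.Adj y x →
          ∃ i, i < p.length ∧ s(p.getVert i, p.getVert (i + 1)) = s(a, b) := by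
        intro he hyx
        rw [← he]
        refine (mk_mem_edges_iff_exists p).1 (hnoclose y ⟨Walk.nil, ?_⟩ hyx)
        intro z hz _
        simpa using hz
      have hside : ∀ a b, a ∈ p.support → a ≠ x → a ≠ y → G.Adj a b →
          ∃ i, i < p.length ∧ s(p.getVert i, p.getVert (i + 1)) = s(a, b) := by
        intro a b ha hax hay hab
        obtain ⟨i, hi, rfl, h2⟩ := hint a ha hax hay
        rcases h2 b hab with rfl | rfl
        · exact ⟨i, by omega, Sym2.eq_swap⟩
        · exact ⟨i + 1, hi, rfl⟩
      by_cases hax : a = x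
      · by_cases hbx : b = x
        · exact absurd (hax.trans hbx.symm) hab.ne
        · by_cases hby : b = y
          · exact hself (by rw [hax, hby, Sym2.eq_swap]) (hax ▸ hby ▸ hab.symm)
          · rw [Sym2.eq_swap (a := a)]
            exact hside b a hb hbx hby hab.symm
      · by_cases hay : a = y
        · by_cases hbx : b = x
          · exact hself (by rw [hay, hbx]) (hay ▸ hbx ▸ hab)
          · have hby : b ≠ y := fun hh => hab.ne (hay.trans hh.symm)
            rw [Sym2.eq_swap (a := a)]
            exact hside b a hb hbx hby hab.symm
        · exact hside a b ha hax hay hab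
    intro a ha b hb hab
    obtain ⟨i, hi, h1⟩ := hstep a ha b hb hab
    have h3 : G.Adj (τ (p.getVert i)) (τ (p.getVert (i + 1))) := by
      rw [hτ i (by omega), hτ (i + 1) (by omega)]
      have := p.adj_getVert_succ (i := p.length - (i + 1)) (by omega)
      rw [show p.length - (i + 1) + 1 = p.length - i by omega] at this
      exact this.symm
    rw [Sym2.eq_iff] at h1
    rcases h1 with ⟨rfl, rfl⟩ | ⟨rfl, rfl⟩
    · exact h3
    · exact h3.symm

theorem numOrientations_le_of_isGGS {n : ℕ} {G₁ G₂ : SimpleGraph (Fin n)} [DecidableRel G₁.Adj]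
    (h : IsGGS G₁ G₂) (r : ℕ) (mu : n.Partition) :
    numOrientations G₂ r mu ≤ numOrientations G₁ r mu := by
  obtain ⟨x, y, p, hxy, hp, hdeg, hcyc, rfl⟩ := h
  obtain ⟨P, S, τ, hc⟩ := exists_shiftConfig p hxy hp hdeg hcyc
  exact hc.numOrientations_le r mu

/-! ### Positivity of the characters -/

open scoped ComplexOrder in

-- This is `tr(A A*) ≥ 0` for `A = ∑ ρ g` over `g ∈ E`, since the adjoint of a unitary `ρ g` is `ρ
-- g⁻¹`.
theorem LinearMap.sum_trace_mul_inv_nonneg {W H : Type*} [NormedAddCommGroup W]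
    [InnerProductSpace ℂ W] [FiniteDimensional ℂ W] [Group H] (ρ : Representation ℂ H W)
    (hρ : ∀ g u v, inner ℂ (ρ g u) (ρ g v) = inner ℂ u v) (E : Finset H) :
    0 ≤ ∑ g ∈ E, ∑ h ∈ E, LinearMap.trace ℂ W (ρ (g * h⁻¹)) := by
  have hadj : ∀ g, LinearMap.adjoint (ρ g) = ρ g⁻¹ := by
    intro g
    refine ((LinearMap.eq_adjoint_iff _ _).2 fun u v => ?_).symm
    rw [← hρ g, ← Module.End.mul_apply, ← map_mul, mul_inv_cancel, map_one, Module.End.one_apply]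
  have hpos := (LinearMap.isPositive_self_comp_adjoint (∑ g ∈ E, ρ g)).trace_nonneg
  have heq : (∑ g ∈ E, ρ g) ∘ₗ LinearMap.adjoint (∑ g ∈ E, ρ g) =
      ∑ g ∈ E, ∑ h ∈ E, ρ (g * h⁻¹) := by
    rw [map_sum, ← Module.End.mul_eq_comp, Finset.sum_mul_sum]
    simp only [hadj, map_mul]
  rw [heq] at hpos
  simpa only [map_sum] using hpos

/-- The standard Hermitian form on finitely supported functions. -/
def finsuppInner {α : Type*} (u v : α →₀ ℂ) : ℂ := u.sum fun a z => starRingEnd ℂ z * v a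

section finsuppInner

variable {α : Type*}

theorem finsuppInner_eq_sum (u v : α →₀ ℂ) {T : Finset α} (hT : u.support ⊆ T) :
    finsuppInner u v = ∑ a ∈ T, starRingEnd ℂ (u a) * v a :=
  Finsupp.sum_of_support_subset u hT _ (by simp)

theorem finsuppInner_conj_symm (u v : α →₀ ℂ) :
    starRingEnd ℂ (finsuppInner v u) = finsuppInner u v := by
  classical
  rw [finsuppInner_eq_sum u v (Finset.subset_union_left (s₂ := v.support)),
    finsuppInner_eq_sum v u (Finset.subset_union_right (s₁ := u.support)), map_sum]
  refine Finset.sum_congr rfl fun a _ => ?_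
  rw [map_mul, Complex.conj_conj, mul_comm]

theorem finsuppInner_add_left (u v z : α →₀ ℂ) :
    finsuppInner (u + v) z = finsuppInner u z + finsuppInner v z := by
  classical
  exact Finsupp.sum_add_index' (by simp) (by simp [add_mul])

theorem finsuppInner_smul_left (u v : α →₀ ℂ) (c : ℂ) :
    finsuppInner (c • u) v = starRingEnd ℂ c * finsuppInner u v := by
  rw [finsuppInner, Finsupp.sum_smul_index (by simp), finsuppInner, Finsupp.mul_sum]
  simp [mul_assoc]

theorem finsuppInner_self (u : α →₀ ℂ) :
    finsuppInner u u = ((∑ a ∈ u.support, Complex.normSq (u a) : ℝ) : ℂ) := by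
  rw [finsuppInner_eq_sum u u subset_rfl, Complex.ofReal_sum]
  exact Finset.sum_congr rfl fun a _ => by rw [mul_comm, Complex.mul_conj]

theorem finsuppInner_definite (u : α →₀ ℂ) (hu : finsuppInner u u = 0) : u = 0 := by
  rw [finsuppInner_self, Complex.ofReal_eq_zero,
    Finset.sum_eq_zero_iff_of_nonneg fun _ _ => Complex.normSq_nonneg _] at hu
  ext a
  by_contra ha
  exact ha (Complex.normSq_eq_zero.1 (hu a (Finsupp.mem_support_iff.2 ha)))

theorem finsuppInner_mapDomain {f : α → α} (hf : Function.Injective f) (u v : α →₀ ℂ) :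
    finsuppInner (u.mapDomain f) (v.mapDomain f) = finsuppInner u v := by
  rw [finsuppInner, Finsupp.sum_mapDomain_index_inj hf]
  simp only [Finsupp.mapDomain_apply hf]
  rfl

/-- The inner product space structure on a space of finitely supported functions. -/
@[reducible]
def finsuppInnerCore (W : Submodule ℂ (α →₀ ℂ)) : InnerProductSpace.Core ℂ W where
  inner u v := finsuppInner u.1 v.1
  conj_inner_symm u v := finsuppInner_conj_symm u.1 v.1
  re_inner_nonneg u := by
    change 0 ≤ (finsuppInner u.1 u.1).re
    rw [finsuppInner_self, Complex.ofReal_re]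
    exact Finset.sum_nonneg fun _ _ => Complex.normSq_nonneg _
  add_left u v z := finsuppInner_add_left u.1 v.1 z.1
  smul_left u v c := finsuppInner_smul_left u.1 v.1 c
  definite u hu := Subtype.ext (finsuppInner_definite u.1 hu)

end finsuppInner

section irrChar

variable {n : ℕ} (lam : n.Partition)

/-- The representation of the symmetric group on the Specht module. -/
def spechtRep : Representation ℂ (Equiv.Perm (Fin n)) (spechtModule lam) where
  toFun σ := (tabloidRep n σ).restrict (tabloidRep_mem_spechtModule lam σ)
  map_one' := by
    ext1 v
    apply Subtype.ext
    simp
  map_mul' σ τ := by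
    ext1 v
    apply Subtype.ext
    simp

theorem irrChar_eq_trace (σ : Equiv.Perm (Fin n)) :
    irrChar lam σ = LinearMap.trace ℂ (spechtModule lam) (spechtRep lam σ) := rfl

theorem irrChar_conj (σ τ : Equiv.Perm (Fin n)) :
    irrChar lam (σ * τ * σ⁻¹) = irrChar lam τ := by
  rw [irrChar_eq_trace, irrChar_eq_trace, map_mul, LinearMap.trace_mul_comm, ← map_mul,
    ← mul_assoc, inv_mul_cancel, one_mul]

theorem irrChar_eq_of_cycleType_eq {σ τ : Equiv.Perm (Fin n)} (h : σ.cycleType = τ.cycleType) :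
    irrChar lam σ = irrChar lam τ := by
  obtain ⟨c, rfl⟩ := isConj_iff.1 (Equiv.Perm.isConj_iff_cycleType_eq.2 h)
  rw [irrChar_conj]

instance finiteDimensional_spechtModule : FiniteDimensional ℂ (spechtModule lam) := by
  have : Finite {c : ℕ × ℕ // c ∈ partitionDiagram lam} :=
    Finite.of_injective (fun c => (⟨c.1, c.2⟩ : (partitionDiagram lam).cells))
      (fun a b h => Subtype.ext (Subtype.ext_iff.1 h))
  exact FiniteDimensional.span_of_finite ℂ (Set.finite_range _)

open scoped ComplexOrder in
-- The group permutes the basis of tabloids, so the standard Hermitian form restricts to an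
-- invariant inner product on the Specht module.
theorem sum_irrChar_mul_inv_nonneg (E : Finset (Equiv.Perm (Fin n))) :
    0 ≤ ∑ g ∈ E, ∑ h ∈ E, irrChar lam (g * h⁻¹) := by
  let core := finsuppInnerCore (spechtModule lam)
  let : NormedAddCommGroup (spechtModule lam) := core.toNormedAddCommGroup
  let : InnerProductSpace ℂ (spechtModule lam) := InnerProductSpace.ofCore core.toCore
  refine LinearMap.sum_trace_mul_inv_nonneg (spechtRep lam) (fun g u v => ?_) E
  exact finsuppInner_mapDomain (fun a b hab => by
    funext i
    simpa using congrFun hab (g i)) u.1 v.1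

end irrChar

/-! ### Parts of permutations and partial functions -/

/-- `ψ` is a product of some of the cycles of `π`. -/
def IsPart {α : Type*} (ψ π : Equiv.Perm α) : Prop := ∀ v, ψ v ≠ v → ψ v = π v

/-- Every nontrivial cycle of `ψ` is a directed cycle of the partial function `O`. -/
def IsPartOf {α : Type*} (ψ : Equiv.Perm α) (O : α → Option α) : Prop :=
  ∀ v, ψ v ≠ v → O v = some (ψ v)

/-- A self-map of a finite set is a bijection on its periodic points; `π` is that bijection,
extended by the identity. Its nontrivial cycles are the directed cycles of `O`. -/
theorem exists_isPartOf_iff_isPart {α : Type*} [Finite α] (O : α → Option α) :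
    ∃ π : Equiv.Perm α, ∀ ψ, IsPartOf ψ O ↔ IsPart ψ π := by
  classical
  -- A vertex without an arrow becomes a fixed point, which creates no nontrivial cycle.
  let f : α → α := fun v => (O v).getD v
  let e : Equiv.Perm (Function.periodicPts f) :=
    Set.BijOn.equiv f (Function.bijOn_periodicPts f)
  have hin : ∀ v ∈ Function.periodicPts f,
      (Equiv.Perm.ofSubtype (p := (· ∈ Function.periodicPts f)) e) v = f v := by
    intro v hv
    rw [Equiv.Perm.ofSubtype_apply_of_mem (p := (· ∈ Function.periodicPts f)) e hv]
    rfl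
  refine ⟨Equiv.Perm.ofSubtype (p := (· ∈ Function.periodicPts f)) e, fun ψ =>
    ⟨fun h v hv => ?_, fun h v hv => ?_⟩⟩
  · have hf : ∀ u, ψ u ≠ u → f u = ψ u := fun u hu => by
      change (O u).getD u = ψ u
      rw [h u hu, Option.getD_some]
    have hmoved : ∀ k, ψ ((ψ ^ k) v) ≠ (ψ ^ k) v := by
      intro k hk
      rw [← Equiv.Perm.mul_apply, ← pow_succ', pow_succ, Equiv.Perm.mul_apply] at hk
      exact hv ((ψ ^ k).injective hk)
    -- The `ψ`-orbit of a moved point consists of moved points, so `f` follows `ψ` along all of it.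
    have hit : ∀ k, f^[k] v = (ψ ^ k) v := by
      intro k
      induction k with
      | zero => rfl
      | succ k ih =>
        rw [Function.iterate_succ_apply', ih, hf _ (hmoved k), pow_succ', Equiv.Perm.mul_apply]
    have hper : v ∈ Function.periodicPts f := by
      refine ⟨orderOf ψ, orderOf_pos ψ, ?_⟩
      rw [Function.IsPeriodicPt, Function.IsFixedPt, hit, pow_orderOf_eq_one, Equiv.Perm.one_apply]
    rw [hin v hper, hf v hv]
  · have h1 := h v hv
    by_cases hper : v ∈ Function.periodicPts f
    · rw [hin v hper] at h1
      change ψ v = (O v).getD v at h1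
      cases hO : O v with
      | none => rw [hO] at h1; exact absurd h1 hv
      | some u => rw [hO] at h1; rw [h1, Option.getD_some]
    · rw [Equiv.Perm.ofSubtype_apply_of_not_mem (p := (· ∈ Function.periodicPts f)) e hper] at h1
      exact absurd h1 hv

section Invariant

variable {α : Type*} {π ψ φ : Equiv.Perm α} {A B : Set α}

/-- `A` is a union of orbits of `π`. -/
def IsOrbitUnion (π : Equiv.Perm α) (A : Set α) : Prop := ∀ v, π v ∈ A ↔ v ∈ A

theorem IsOrbitUnion.union (hA : IsOrbitUnion π A) (hB : IsOrbitUnion π B) :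
    IsOrbitUnion π (A ∪ B) := fun v => or_congr (hA v) (hB v)

theorem IsOrbitUnion.inter (hA : IsOrbitUnion π A) (hB : IsOrbitUnion π B) :
    IsOrbitUnion π (A ∩ B) := fun v => and_congr (hA v) (hB v)

theorem IsOrbitUnion.diff (hA : IsOrbitUnion π A) (hB : IsOrbitUnion π B) :
    IsOrbitUnion π (A \ B) := fun v => and_congr (hA v) (not_congr (hB v))

theorem IsPart.isOrbitUnion (h : IsPart ψ π) : IsOrbitUnion π {v | ψ v ≠ v} := by
  intro v
  constructor
  · intro hv
    have hmv : ψ (ψ.symm (π v)) ≠ ψ.symm (π v) := by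
      intro hh
      rw [Equiv.apply_symm_apply] at hh
      apply hv
      nth_rw 1 [hh]
      rw [Equiv.apply_symm_apply]
    have := h _ hmv
    rw [Equiv.apply_symm_apply] at this
    have hv' := π.injective this
    rw [← hv'] at hmv
    exact hmv
  · intro hv
    change ψ (π v) ≠ π v
    rw [← h v hv]
    exact fun hh => hv (ψ.injective hh)

open Classical in
/-- The restriction of `π` to an invariant set `A`, extended by the identity. -/
def permOn (π : Equiv.Perm α) (A : Set α) : Equiv.Perm α :=
  if h : IsOrbitUnion π A then Equiv.Perm.ofSubtype (p := (· ∈ A)) (π.subtypePerm h) else 1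

open Classical in
theorem permOn_of_mem (hA : IsOrbitUnion π A) {v : α} (hv : v ∈ A) : permOn π A v = π v := by
  rw [permOn, dif_pos hA, Equiv.Perm.ofSubtype_apply_of_mem (p := (· ∈ A)) _ hv]
  rfl

open Classical in
theorem permOn_of_notMem (hA : IsOrbitUnion π A) {v : α} (hv : v ∉ A) : permOn π A v = v := by
  rw [permOn, dif_pos hA, Equiv.Perm.ofSubtype_apply_of_not_mem (p := (· ∈ A)) _ hv]

theorem isPart_permOn (hA : IsOrbitUnion π A) : IsPart (permOn π A) π := by
  intro v hv
  by_cases hvA : v ∈ A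
  · exact permOn_of_mem hA hvA
  · exact absurd (permOn_of_notMem hA hvA) hv

theorem IsPart.eq_permOn (h : IsPart ψ π) : permOn π {v | ψ v ≠ v} = ψ := by
  ext v
  by_cases hv : ψ v = v
  · rw [permOn_of_notMem h.isOrbitUnion (by simpa using hv), hv]
  · rw [permOn_of_mem h.isOrbitUnion hv, h v hv]

theorem disjoint_permOn (hA : IsOrbitUnion π A) (hB : IsOrbitUnion π B) (hAB : Disjoint A B) :
    (permOn π A).Disjoint (permOn π B) := by
  intro v
  by_cases hv : v ∈ A
  · exact Or.inr (permOn_of_notMem hB (Set.disjoint_left.1 hAB hv))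
  · exact Or.inl (permOn_of_notMem hA hv)

theorem permOn_mul (hA : IsOrbitUnion π A) (hB : IsOrbitUnion π B) (hAB : Disjoint A B) :
    permOn π A * permOn π B = permOn π (A ∪ B) := by
  ext v
  rw [Equiv.Perm.mul_apply]
  by_cases hB' : v ∈ B
  · rw [permOn_of_mem hB hB', permOn_of_mem (hA.union hB) (Or.inr hB'),
      permOn_of_notMem hA (fun hh => Set.disjoint_left.1 hAB ((hA v).1 hh) hB')]
  · rw [permOn_of_notMem hB hB']
    by_cases hA' : v ∈ A
    · rw [permOn_of_mem hA hA', permOn_of_mem (hA.union hB) (Or.inl hA')]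
    · rw [permOn_of_notMem hA hA', permOn_of_notMem (hA.union hB) (by simp [hA', hB'])]

/-- The product of the cycles of `π` that belong to exactly one of `ψ` and `φ`. -/
def partSymmDiff (π ψ φ : Equiv.Perm α) : Equiv.Perm α :=
  permOn π (symmDiff {v | ψ v ≠ v} {v | φ v ≠ v})

theorem IsPart.isOrbitUnion_symmDiff (h : IsPart ψ π) (h' : IsPart φ π) :
    IsOrbitUnion π (symmDiff {v | ψ v ≠ v} {v | φ v ≠ v}) :=
  (h.isOrbitUnion.diff h'.isOrbitUnion).union (h'.isOrbitUnion.diff h.isOrbitUnion)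

theorem IsPart.partSymmDiff (h : IsPart ψ π) (h' : IsPart φ π) :
    IsPart (partSymmDiff π ψ φ) π :=
  isPart_permOn (h.isOrbitUnion_symmDiff h')

theorem IsPart.partSymmDiff_partSymmDiff (h : IsPart ψ π) (h' : IsPart φ π) :
    _root_.partSymmDiff π (_root_.partSymmDiff π ψ φ) φ = ψ := by
  have hmoved : {v | _root_.partSymmDiff π ψ φ v ≠ v} =
      symmDiff {v | ψ v ≠ v} {v | φ v ≠ v} := by
    ext v
    constructor
    · intro hv
      by_contra hv'
      exact hv (permOn_of_notMem (h.isOrbitUnion_symmDiff h') hv')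
    · intro hv
      change permOn π _ v ≠ v
      rw [permOn_of_mem (h.isOrbitUnion_symmDiff h') hv]
      rcases hv with ⟨hv, -⟩ | ⟨hv, -⟩
      · exact h v hv ▸ hv
      · exact h' v hv ▸ hv
  rw [_root_.partSymmDiff, hmoved, symmDiff_symmDiff_cancel_right, h.eq_permOn]

/-- The common cycles cancel, and inverting the cycles that belong to `φ` alone does not change
their lengths. -/
theorem IsPart.cycleType_mul_inv [Fintype α] [DecidableEq α] (h : IsPart ψ π) (h' : IsPart φ π) :
    (ψ * φ⁻¹).cycleType = (_root_.partSymmDiff π ψ φ).cycleType := by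
  have hA := h.isOrbitUnion
  have hB := h'.isOrbitUnion
  have e1 := h.eq_permOn
  have e2 := h'.eq_permOn
  unfold _root_.partSymmDiff
  set A : Set α := {v | ψ v ≠ v}
  set B : Set α := {v | φ v ≠ v}
  have d : Disjoint (A \ B) (B \ A) := disjoint_sdiff_sdiff
  have hψ : ψ = permOn π (A \ B) * permOn π (A ∩ B) := by
    rw [permOn_mul (hA.diff hB) (hA.inter hB) Set.disjoint_sdiff_inter, Set.sdiff_union_inter, e1]
  have hφ : φ = permOn π (B \ A) * permOn π (A ∩ B) := by
    rw [Set.inter_comm, permOn_mul (hB.diff hA) (hB.inter hA) Set.disjoint_sdiff_inter,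
      Set.sdiff_union_inter, e2]
  have hprod : ψ * φ⁻¹ = permOn π (A \ B) * (permOn π (B \ A))⁻¹ := by
    rw [hφ]
    nth_rw 1 [hψ]
    group
  have hdisj := disjoint_permOn (hA.diff hB) (hB.diff hA) d
  rw [hprod, hdisj.inv_right.cycleType_mul, Equiv.Perm.cycleType_inv, Set.symmDiff_def,
    ← permOn_mul (hA.diff hB) (hB.diff hA) d, hdisj.cycleType_mul]

end Invariant

open Classical in
/-- The sum of `f` over all products of cycles of `π`. -/
def partSum {α : Type*} [Fintype α] (f : Equiv.Perm α → ℂ) (π : Equiv.Perm α) : ℂ :=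
  ∑ ψ with IsPart ψ π, f ψ

theorem isPart_conj {α : Type*} (σ ψ π : Equiv.Perm α) :
    IsPart (σ * ψ * σ⁻¹) (σ * π * σ⁻¹) ↔ IsPart ψ π := by
  constructor
  · intro h v hv
    have := h (σ v) (by simpa using hv)
    simpa using this
  · intro h v hv
    obtain ⟨u, rfl⟩ := σ.surjective v
    have := h u (fun hh => hv (by simp [hh]))
    simp [this]

section partSum

open scoped ComplexOrder

variable {α : Type*} [Fintype α] [DecidableEq α] {f : Equiv.Perm α → ℂ}

theorem partSum_eq_of_cycleType_eq (hf : ∀ σ τ, σ.cycleType = τ.cycleType → f σ = f τ)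
    {π π' : Equiv.Perm α} (h : π.cycleType = π'.cycleType) : partSum f π = partSum f π' := by
  classical
  obtain ⟨c, rfl⟩ := isConj_iff.1 (Equiv.Perm.isConj_iff_cycleType_eq.2 h)
  refine Finset.sum_equiv (MulAut.conj c).toEquiv (fun ψ => ?_) (fun ψ _ => ?_)
  · simp [isPart_conj]
  · exact hf _ _ (by simp)

/-- For fixed `φ`, symmetric difference with `φ` is an involution on the parts of `π`. Each inner
sum over `ψ` thus equals `partSum f π`, and the nonnegative double sum is a positive multiple of it.
-/
theorem partSum_nonneg (hf : ∀ σ τ, σ.cycleType = τ.cycleType → f σ = f τ)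
    (hpos : ∀ E : Finset (Equiv.Perm α), 0 ≤ ∑ g ∈ E, ∑ h ∈ E, f (g * h⁻¹))
    (π : Equiv.Perm α) : 0 ≤ partSum f π := by
  classical
  obtain ⟨E, hE⟩ : ∃ E : Finset (Equiv.Perm α), E = Finset.univ.filter fun ψ => IsPart ψ π :=
    ⟨_, rfl⟩
  have hmem : ∀ ψ, ψ ∈ E ↔ IsPart ψ π := fun ψ => by simp [hE]
  have hsum : partSum f π = ∑ ψ ∈ E, f ψ := by
    rw [hE, partSum]
    congr!
  have hrow : ∀ φ ∈ E, ∑ ψ ∈ E, f (ψ * φ⁻¹) = partSum f π := by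
    intro φ hφ
    rw [hmem] at hφ
    rw [hsum]
    refine Finset.sum_bij' (fun ψ _ => partSymmDiff π ψ φ) (fun ψ _ => partSymmDiff π ψ φ)
      ?_ ?_ ?_ ?_ ?_
    · exact fun ψ hψ => (hmem _).2 (((hmem _).1 hψ).partSymmDiff hφ)
    · exact fun ψ hψ => (hmem _).2 (((hmem _).1 hψ).partSymmDiff hφ)
    · exact fun ψ hψ => ((hmem _).1 hψ).partSymmDiff_partSymmDiff hφ
    · exact fun ψ hψ => ((hmem _).1 hψ).partSymmDiff_partSymmDiff hφ
    · exact fun ψ hψ => hf _ _ (((hmem _).1 hψ).cycleType_mul_inv hφ)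
  have h := hpos E
  rw [Finset.sum_comm, Finset.sum_congr rfl hrow, Finset.sum_const, nsmul_eq_mul] at h
  have hcard : 0 < E.card :=
    Finset.card_pos.2 ⟨1, (hmem 1).2 fun v hv => absurd (Equiv.Perm.one_apply v) hv⟩
  have hcard' : (0 : ℝ) < E.card := by exact_mod_cast hcard
  rw [Complex.nonneg_iff, ← Complex.ofReal_natCast, Complex.re_ofReal_mul,
    Complex.im_ofReal_mul] at h
  exact Complex.nonneg_iff.2 ⟨nonneg_of_mul_nonneg_right h.1 hcard',
    ((mul_eq_zero.1 h.2.symm).resolve_left hcard'.ne').symm⟩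

end partSum

/-! ### Laplacian immanantal coefficients as sums over orientations -/

open Classical in
/-- The functions `O` that assign arrows along edges of `G` to exactly `r` vertices. -/
def arrowFunctions {n : ℕ} (G : SimpleGraph (Fin n)) (r : ℕ) : Finset (Fin n → Option (Fin n)) :=
  Finset.univ.filter fun O =>
    (∀ v u, O v = some u → G.Adj v u) ∧ (Finset.univ.filter fun v => (O v).isSome).card = r

theorem mem_orientations_iff {n : ℕ} (G : SimpleGraph (Fin n)) (r : ℕ) (mu : n.Partition)
    (O : Fin n → Option (Fin n)) :
    O ∈ orientations G r mu ↔ O ∈ arrowFunctions G r ∧ HasType O mu := by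
  classical
  simp only [orientations, arrowFunctions, Finset.mem_filter, Finset.mem_univ, true_and]
  refine and_congr_left fun _ => ⟨?_, fun h => ⟨_, h.2, fun v => by simp, h.1⟩⟩
  rintro ⟨B, rfl, hB, hadj⟩
  refine ⟨hadj, congrArg Finset.card ?_⟩
  ext v
  simp [hB]

section Expansion

variable {n : ℕ} {G : SimpleGraph (Fin n)}

/-- Bipartiteness enters only here. The `±1` colouring changes sign exactly at moved points, while
its total product is invariant under reindexing by `ψ`. -/
theorem prod_ite_eq_one_of_isBipartite (hG : G.IsBipartite) (ψ : Equiv.Perm (Fin n))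
    (hψ : ∀ v, ψ v ≠ v → G.Adj v (ψ v)) :
    ∏ v, (if ψ v = v then (1 : ℂ[X]) else -1) = 1 := by
  obtain ⟨C⟩ := hG
  let f : Fin n → ℂ[X] := fun v => if C v = 0 then 1 else -1
  have hf : ∀ v, f v ≠ 0 := fun v => by
    change (if C v = 0 then (1 : ℂ[X]) else -1) ≠ 0
    split_ifs <;> simp
  have hstep : ∀ v, f (ψ v) = (if ψ v = v then (1 : ℂ[X]) else -1) * f v := by
    intro v
    by_cases hv : ψ v = v
    · rw [if_pos hv, hv, one_mul]
    · rw [if_neg hv]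
      have := C.valid (hψ v hv)
      change (if C (ψ v) = 0 then (1 : ℂ[X]) else -1) = -1 * (if C v = 0 then (1 : ℂ[X]) else -1)
      by_cases h0 : C v = 0
      · rw [if_pos h0, if_neg (fun hh => this (h0.trans hh.symm)), mul_one]
      · rw [if_neg h0, if_pos (by omega)]
        simp
  have hprod : ∏ v, f (ψ v) = ∏ v, f v := Equiv.prod_comp ψ f
  simp only [hstep, Finset.prod_mul_distrib] at hprod
  exact mul_right_cancel₀ (Finset.prod_ne_zero_iff.2 fun v _ => hf v)
    (hprod.trans (one_mul _).symm)

open Classical in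
/-- The contribution of a vertex `i` with arrow `o` to the product `∏ᵢ (xI - L) i (ψ i)`. -/
def arrowWeight (G : SimpleGraph (Fin n)) (ψ : Equiv.Perm (Fin n)) (i : Fin n) :
    Option (Fin n) → ℂ[X]
  | none => if ψ i = i then X else 0
  | some u => if G.Adj i u then if ψ i = i then -1 else if ψ i = u then 1 else 0 else 0

/-- A diagonal entry `X - deg i` splits into `X` for no arrow and `-1` for each neighbour; an
off-diagonal entry receives only the arrow `i → ψ i`. -/
theorem sum_arrowWeight [DecidableRel G.Adj] (ψ : Equiv.Perm (Fin n)) (i : Fin n) :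
    ∑ o, arrowWeight G ψ i o = Matrix.charmatrix (G.lapMatrix ℂ) i (ψ i) := by
  classical
  rw [Fintype.sum_option, Matrix.charmatrix_apply, SimpleGraph.lapMatrix, Matrix.sub_apply]
  by_cases hi : ψ i = i
  · simp only [arrowWeight, hi, if_true, Matrix.diagonal_apply_eq, SimpleGraph.degMatrix,
      SimpleGraph.adjMatrix_apply, SimpleGraph.irrefl, if_false, sub_zero]
    rw [← Finset.sum_filter, Finset.sum_const, ← SimpleGraph.card_neighborFinset_eq_degree,
      SimpleGraph.neighborFinset_eq_filter]
    simp [sub_eq_add_neg]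
  · have hi' : i ≠ ψ i := fun hh => hi hh.symm
    simp only [arrowWeight, hi, if_false, Matrix.diagonal_apply_ne _ hi', SimpleGraph.degMatrix,
      SimpleGraph.adjMatrix_apply, zero_add, zero_sub]
    rw [Finset.sum_eq_single (ψ i)]
    · by_cases h : G.Adj i (ψ i) <;> simp [h]
    · intro u _ hu
      simp [hu.symm]
    · simp

open Classical in
theorem prod_arrowWeight (hG : G.IsBipartite) (ψ : Equiv.Perm (Fin n))
    (O : Fin n → Option (Fin n)) :
    ∏ i, arrowWeight G ψ i (O i) =
      if (∀ v u, O v = some u → G.Adj v u) ∧ IsPartOf ψ O then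
        (-1) ^ (Finset.univ.filter fun v => (O v).isSome).card *
          X ^ (n - (Finset.univ.filter fun v => (O v).isSome).card) else 0 := by
  split_ifs with h
  · obtain ⟨hadj, hpart⟩ := h
    -- The weight `1` of an arrow at a moved vertex is written as `(-1) * (-1)`, so that every arrow
    -- contributes `-1` and the extra signs multiply to `1`.
    have hi : ∀ i, arrowWeight G ψ i (O i) =
        (if ψ i = i then 1 else -1) * (if (O i).isSome then -1 else X) := by
      intro i
      cases hO : O i with
      | none =>
        have : ψ i = i := by
          by_contra hne
          rw [hpart i hne] at hO
          exact Option.some_ne_none _ hO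
        simp [arrowWeight, this]
      | some u =>
        have hiu := hadj i u hO
        by_cases hne : ψ i = i
        · simp [arrowWeight, hne, hiu]
        · have : ψ i = u := by
            have := hpart i hne
            rw [hO] at this
            exact (Option.some.inj this).symm
          have hui : u ≠ i := hiu.ne'
          simp [arrowWeight, this, hui, hiu]
    simp only [hi]
    rw [Finset.prod_mul_distrib, prod_ite_eq_one_of_isBipartite hG ψ
      (fun v hv => hadj _ _ (hpart v hv)), one_mul, Finset.prod_ite, Finset.prod_const,
      Finset.prod_const, ← Finset.compl_filter, Finset.card_compl, Fintype.card_fin]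
  · rw [Finset.prod_eq_zero_iff]
    rw [not_and_or] at h
    rcases h with h | h
    · push Not at h
      obtain ⟨v, u, hO, hadj⟩ := h
      exact ⟨v, Finset.mem_univ v, by simp [arrowWeight, hO, hadj]⟩
    · unfold IsPartOf at h
      push Not at h
      obtain ⟨v, hv, hO⟩ := h
      refine ⟨v, Finset.mem_univ v, ?_⟩
      cases hOv : O v with
      | none => simp [arrowWeight, hv]
      | some u =>
        have : ψ v ≠ u := fun hh => hO (hOv.trans (congrArg some hh.symm))
        simp [arrowWeight, hv, this]

open Classical in
/-- The sum of `χ_lam` over all products of directed cycles of `O`. -/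
def orientationWeight (lam : n.Partition) (O : Fin n → Option (Fin n)) : ℂ :=
  ∑ ψ : Equiv.Perm (Fin n) with IsPartOf ψ O, irrChar lam ψ

theorem immanantalCoeff_lapMatrix [DecidableRel G.Adj] (hG : G.IsBipartite) (lam : n.Partition)
    {r : ℕ} (hr : r ≤ n) :
    immanantalCoeff lam r (G.lapMatrix ℂ) = ∑ O ∈ arrowFunctions G r, orientationWeight lam O := by
  classical
  have hcoeff : ∀ (ψ : Equiv.Perm (Fin n)) (O : Fin n → Option (Fin n)),
      (-1) ^ r * (∏ i, arrowWeight G ψ i (O i)).coeff (n - r) =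
        if O ∈ arrowFunctions G r ∧ IsPartOf ψ O then 1 else 0 := by
    intro ψ O
    rw [prod_arrowWeight hG]
    have hcard : (Finset.univ.filter fun v => (O v).isSome).card ≤ n := by
      simpa using Finset.card_filter_le (Finset.univ : Finset (Fin n)) (fun v => (O v).isSome)
    simp only [arrowFunctions, Finset.mem_filter, Finset.mem_univ, true_and]
    generalize (Finset.univ.filter fun v => (O v).isSome).card = s at hcard ⊢
    by_cases h1 : (∀ v u, O v = some u → G.Adj v u) ∧ IsPartOf ψ O
    · have hsign : ((-1 : ℂ[X]) ^ s * X ^ (n - s)).coeff (n - r) =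
          (-1) ^ s * if n - r = n - s then 1 else 0 := by
        rw [show (-1 : ℂ[X]) ^ s = C ((-1) ^ s) by simp, coeff_C_mul, coeff_X_pow]
      rw [if_pos h1, hsign]
      by_cases hs : s = r
      · subst hs
        rw [if_pos rfl, if_pos ⟨⟨h1.1, rfl⟩, h1.2⟩, mul_one, ← mul_pow]
        simp
      -- Since `r` and `s` are at most `n`, truncated subtraction loses nothing: `n - r = n - s`
      -- would give `s = r`.
      · rw [if_neg (by omega), if_neg (fun hh => hs hh.1.2), mul_zero, mul_zero]
    · rw [if_neg h1, if_neg (fun hh => h1 ⟨hh.1.1, hh.2⟩), coeff_zero, mul_zero]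
  have hexp : immanantalCoeff lam r (G.lapMatrix ℂ) = ∑ ψ : Equiv.Perm (Fin n),
      ∑ O : Fin n → Option (Fin n),
        if O ∈ arrowFunctions G r ∧ IsPartOf ψ O then irrChar lam ψ else 0 := by
    rw [immanantalCoeff, immanantalPolynomial, immanant, finsetSum_coeff, Finset.mul_sum]
    refine Finset.sum_congr rfl fun ψ _ => ?_
    rw [coeff_smul, smul_eq_mul, mul_left_comm]
    simp only [← sum_arrowWeight]
    rw [Fintype.prod_sum, finsetSum_coeff, Finset.mul_sum, Finset.mul_sum]
    refine Finset.sum_congr rfl fun O _ => ?_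
    rw [hcoeff, mul_ite, mul_one, mul_zero]
  rw [hexp, Finset.sum_comm, ← Finset.sum_filter_add_sum_filter_not Finset.univ
    (· ∈ arrowFunctions G r), Finset.sum_eq_zero (s := Finset.univ.filter fun O =>
    O ∉ arrowFunctions G r), add_zero, Finset.filter_mem_eq_inter, Finset.univ_inter]
  · refine Finset.sum_congr rfl fun O hO => ?_
    rw [orientationWeight, Finset.sum_filter]
    simp only [hO, true_and]
  · intro O hO
    rw [Finset.mem_filter] at hO
    simp [hO.2]

end Expansion

/-! ### Types of orientations -/

section HasType

variable {n : ℕ} {O O' : Fin n → Option (Fin n)} {mu nu : n.Partition}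

theorem isDirectedCycle_iff {π : Equiv.Perm (Fin n)} (h : ∀ ψ, IsPartOf ψ O ↔ IsPart ψ π)
    (c : Equiv.Perm (Fin n)) : IsDirectedCycle O c ↔ c ∈ π.cycleFactorsFinset := by
  rw [Equiv.Perm.mem_cycleFactorsFinset_iff]
  refine and_congr_right fun _ => ?_
  simp only [Equiv.Perm.mem_support]
  exact h c

theorem numDirectedCycles_eq_count {π : Equiv.Perm (Fin n)}
    (h : ∀ ψ, IsPartOf ψ O ↔ IsPart ψ π) (i : ℕ) :
    numDirectedCycles O i = π.cycleType.count i := by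
  classical
  rw [numDirectedCycles, Equiv.Perm.cycleType_def, Multiset.count_map, ← Finset.filter_val,
    Finset.card_val]
  congr 1
  ext c
  simp [isDirectedCycle_iff h, eq_comm]

theorem hasType_iff {π : Equiv.Perm (Fin n)} (h : ∀ ψ, IsPartOf ψ O ↔ IsPart ψ π) :
    HasType O mu ↔ mu.parts.filter (2 ≤ ·) = π.cycleType := by
  simp only [HasType, numDirectedCycles_eq_count h]
  constructor
  · intro hmu
    ext i
    by_cases hi : 2 ≤ i
    · rw [Multiset.count_filter_of_pos hi, hmu i hi]
    · rw [Multiset.count_filter_of_neg hi, eq_comm, Multiset.count_eq_zero]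
      exact fun hh => hi (Equiv.Perm.two_le_of_mem_cycleType hh)
  · intro hmu i hi
    rw [← hmu, Multiset.count_filter_of_pos hi]

/-- The remaining parts are all `1`, and the total `n` fixes their number. -/
theorem Nat.Partition.eq_of_filter_two_le_eq
    (h : mu.parts.filter (2 ≤ ·) = nu.parts.filter (2 ≤ ·)) : mu = nu := by
  have hsplit : ∀ mu : n.Partition, ∃ k, mu.parts = mu.parts.filter (2 ≤ ·) +
      Multiset.replicate k 1 := by
    intro mu
    refine ⟨(mu.parts.filter (¬2 ≤ ·)).card, ?_⟩
    have hone : mu.parts.filter (¬2 ≤ ·) =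
        Multiset.replicate (mu.parts.filter (¬2 ≤ ·)).card 1 := by
      refine Multiset.eq_replicate_card.2 fun i hi => ?_
      have h1 := mu.parts_pos (Multiset.mem_of_mem_filter hi)
      have h2 := Multiset.of_mem_filter hi
      omega
    rw [← hone, Multiset.filter_add_not]
  obtain ⟨k, hk⟩ := hsplit mu
  obtain ⟨l, hl⟩ := hsplit nu
  have hmu := mu.parts_sum
  have hnu := nu.parts_sum
  rw [hk, Multiset.sum_add, Multiset.sum_replicate, h] at hmu
  rw [hl, Multiset.sum_add, Multiset.sum_replicate] at hnu
  simp only [smul_eq_mul, mul_one] at hmu hnu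
  have hkl : k = l := by omega
  exact Nat.Partition.ext (by rw [hk, hl, h, hkl])

theorem HasType.unique (h : HasType O mu) (h' : HasType O nu) : mu = nu := by
  obtain ⟨π, hπ⟩ := exists_isPartOf_iff_isPart O
  exact Nat.Partition.eq_of_filter_two_le_eq
    (((hasType_iff hπ).1 h).trans ((hasType_iff hπ).1 h').symm)

theorem exists_hasType (O : Fin n → Option (Fin n)) : ∃ mu : n.Partition, HasType O mu := by
  obtain ⟨π, hπ⟩ := exists_isPartOf_iff_isPart O
  have hsum : (π.cycleType + Multiset.replicate (n - π.support.card) 1).sum = n := by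
    have := π.support.card_le_univ
    rw [Fintype.card_fin] at this
    rw [Multiset.sum_add, Equiv.Perm.sum_cycleType, Multiset.sum_replicate]
    simp only [smul_eq_mul, mul_one]
    omega
  refine ⟨⟨π.cycleType + Multiset.replicate (n - π.support.card) 1, fun {i} hi => ?_, hsum⟩,
    (hasType_iff hπ).2 ?_⟩
  · rcases Multiset.mem_add.1 hi with hi | hi
    · exact lt_of_lt_of_le two_pos (Equiv.Perm.two_le_of_mem_cycleType hi)
    · rw [Multiset.eq_of_mem_replicate hi]
      exact one_pos
  · change Multiset.filter _ (_ + _) = _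
    rw [Multiset.filter_add, Multiset.filter_eq_self.2
      fun i hi => Equiv.Perm.two_le_of_mem_cycleType hi, Multiset.filter_eq_nil.2, add_zero]
    intro i hi
    rw [Multiset.eq_of_mem_replicate hi]
    norm_num

theorem orientationWeight_eq_partSum (lam : n.Partition) {π : Equiv.Perm (Fin n)}
    (h : ∀ ψ, IsPartOf ψ O ↔ IsPart ψ π) :
    orientationWeight lam O = partSum (irrChar lam) π := by
  classical
  simp only [orientationWeight, partSum, h]
  congr!

/-- The type determines the cycle type of `π`, hence its conjugacy class, and the character is a
class function. -/
theorem orientationWeight_eq_of_hasType (lam : n.Partition) (h : HasType O mu)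
    (h' : HasType O' mu) : orientationWeight lam O = orientationWeight lam O' := by
  obtain ⟨π, hπ⟩ := exists_isPartOf_iff_isPart O
  obtain ⟨π', hπ'⟩ := exists_isPartOf_iff_isPart O'
  rw [orientationWeight_eq_partSum lam hπ, orientationWeight_eq_partSum lam hπ']
  exact partSum_eq_of_cycleType_eq (fun _ _ => irrChar_eq_of_cycleType_eq lam)
    (((hasType_iff hπ).1 h).symm.trans ((hasType_iff hπ').1 h'))

open scoped ComplexOrder in
theorem orientationWeight_nonneg (lam : n.Partition) (O : Fin n → Option (Fin n)) :
    0 ≤ orientationWeight lam O := by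
  obtain ⟨π, hπ⟩ := exists_isPartOf_iff_isPart O
  rw [orientationWeight_eq_partSum lam hπ]
  exact partSum_nonneg (fun _ _ => irrChar_eq_of_cycleType_eq lam)
    (sum_irrChar_mul_inv_nonneg lam) π

theorem sum_arrowFunctions_eq (G : SimpleGraph (Fin n)) (r : ℕ)
    (f : (Fin n → Option (Fin n)) → ℂ) :
    ∑ O ∈ arrowFunctions G r, f O = ∑ mu : n.Partition, ∑ O ∈ orientations G r mu, f O := by
  classical
  choose typ htyp using fun O : Fin n → Option (Fin n) => exists_hasType O
  rw [← Finset.sum_fiberwise (arrowFunctions G r) typ]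
  refine Finset.sum_congr rfl fun mu _ => Finset.sum_congr ?_ fun _ _ => rfl
  ext O
  rw [Finset.mem_filter, mem_orientations_iff]
  exact and_congr_right fun _ => ⟨fun h => h ▸ htyp O, fun h => (htyp O).unique h⟩

open scoped ComplexOrder in
-- Grouped by type, each side is a sum of orientation counts times nonnegative weights that do not
-- depend on the graph.
theorem sum_orientationWeight_le {G₁ G₂ : SimpleGraph (Fin n)} {r : ℕ} (lam : n.Partition)
    (h : ∀ mu : n.Partition, numOrientations G₂ r mu ≤ numOrientations G₁ r mu) :
    ∑ O ∈ arrowFunctions G₂ r, orientationWeight lam O ≤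
      ∑ O ∈ arrowFunctions G₁ r, orientationWeight lam O := by
  rw [sum_arrowFunctions_eq, sum_arrowFunctions_eq]
  refine Finset.sum_le_sum fun mu _ => ?_
  -- A member `O₀` supplies the common weight of the type; if there is none, the left side is zero.
  rcases (orientations G₂ r mu).eq_empty_or_nonempty with h0 | ⟨O₀, hO₀⟩
  · rw [h0, Finset.sum_empty]
    exact Finset.sum_nonneg fun O _ => orientationWeight_nonneg lam O
  · have hconst : ∀ G : SimpleGraph (Fin n), ∑ O ∈ orientations G r mu, orientationWeight lam O =
        (numOrientations G r mu : ℂ) * orientationWeight lam O₀ := by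
      intro G
      rw [numOrientations, ← nsmul_eq_mul, ← Finset.sum_const]
      exact Finset.sum_congr rfl fun O hO => orientationWeight_eq_of_hasType lam
        ((mem_orientations_iff _ _ _ _).1 hO).2 ((mem_orientations_iff _ _ _ _).1 hO₀).2
    rw [hconst, hconst]
    exact mul_le_mul_of_nonneg_right (by exact_mod_cast h mu) (orientationWeight_nonneg lam O₀)

end HasType

end

theorem theorem5p3 (n : ℕ) (G₁ G₂ : SimpleGraph (Fin n)) [DecidableRel G₁.Adj]
    [DecidableRel G₂.Adj] (h₁ : G₁.IsBipartite) (h₂ : G₂.IsBipartite) (hG : IsGGS G₁ G₂) :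
    (∀ (r : ℕ) (mu : n.Partition), numOrientations G₂ r mu ≤ numOrientations G₁ r mu) ∧
    (∀ (lam : n.Partition) (r : ℕ), r ≤ n →
      (immanantalCoeff lam r (G₁.lapMatrix ℂ)).im = 0 ∧
      (immanantalCoeff lam r (G₂.lapMatrix ℂ)).im = 0 ∧
      (immanantalCoeff lam r (G₂.lapMatrix ℂ)).re ≤
        (immanantalCoeff lam r (G₁.lapMatrix ℂ)).re) := by
  have hle : ∀ (r : ℕ) (mu : n.Partition), numOrientations G₂ r mu ≤ numOrientations G₁ r mu :=
    fun r mu => numOrientations_le_of_isGGS hG r mu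
  refine ⟨hle, fun lam r hr => ?_⟩
  rw [immanantalCoeff_lapMatrix h₁ lam hr, immanantalCoeff_lapMatrix h₂ lam hr]
  have him : ∀ G : SimpleGraph (Fin n),
      (∑ O ∈ arrowFunctions G r, orientationWeight lam O).im = 0 := by
    intro G
    rw [Complex.im_sum]
    exact Finset.sum_eq_zero fun O _ =>
      (Complex.nonneg_iff.1 (orientationWeight_nonneg lam O)).2.symm
  exact ⟨him G₁, him G₂, (Complex.le_def.1 (sum_orientationWeight_le lam (hle r))).1⟩
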